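/- For $m\ge 0$ equip $\mathbb R^{2m}$ with coordinates $(x_1,\dots,x_m,y_1,\dots,y_m)$ and the standard symplectic form $\omega_0=\sum_{i=1}^m dx_i\wedge dy_i$, and let $B^{2m}(\rho)\subset\mathbb R^{2m}$ denote the Euclidean ball of radius $\rho$ centred at the origin; products carry the sum of the standard forms, so that $\mathbb R^{2}\times\mathbb R^{2(n-1)}$ and $\mathbb R^{4}\times\mathbb R^{2(n-2)}$ are both the standard $\mathbb R^{2n}$. A symplectic embedding of a subset $A$ into a subset $B$ is a map $A\to B$ that is the restriction of a smooth embedding $\varphi$, with $\varphi^*\omega_0=\omega_0$, of an open neighbourhood of $A$. **Theorem.** Let $n\ge 3$. For every $R>\sqrt3$ and every $S>0$ there exists a symplectic embedding of $B^2(1)\times B^{2(n-1)}(S)$ into $B^4(R)\times\mathbb R^{2(n-2)}$. (Here the balls $B^2(1)$ and $B^{2(n-1)}(S)$ may be taken closed and $B^4(R)$ open.) -/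

import Mathlib

open scoped ContDiff

/-- The Euclidean space `ℝ²ⁿ`; the coordinates of a point `p` are
`xᵢ = p (Sum.inl i)` and `yᵢ = p (Sum.inr i)`. -/
abbrev R2 (n : ℕ) : Type := EuclideanSpace ℝ (Fin n ⊕ Fin n)

/-- The standard symplectic form `ω₀ = ∑ᵢ dxᵢ ∧ dyᵢ` on `ℝ²ⁿ`. -/
def stdForm {n : ℕ} (u v : R2 n) : ℝ :=
  ∑ i : Fin n, (u (Sum.inl i) * v (Sum.inr i) - u (Sum.inr i) * v (Sum.inl i))

/-- The standard symplectic form of `ℝ²⁽ᵃ⁺ᵇ⁾ = ℝ²ᵃ × ℝ²ᵇ`, i.e. `ω₀ ⊕ ω₀`. -/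
def prodForm {a b : ℕ} (u v : R2 a × R2 b) : ℝ :=
  stdForm u.1 v.1 + stdForm u.2 v.2

/-- `φ` restricts to a symplectic embedding of the open set `U ⊆ ℝ²ᵃ × ℝ²ᵇ` into `ℝ²ᶜ × ℝ²ᵈ`:
it is smooth on `U`, pulls the standard symplectic form back to the standard symplectic form
(so it is an immersion), and is a homeomorphism of `U` onto its image. -/
structure IsSymplecticEmbeddingOn {a b c d : ℕ} (φ : R2 a × R2 b → R2 c × R2 d)
    (U : Set (R2 a × R2 b)) : Prop where
  isOpen : IsOpen U
  contDiffOn : ContDiffOn ℝ ∞ φ U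
  pullback_eq : ∀ p ∈ U, ∀ u v : R2 a × R2 b,
    prodForm (fderiv ℝ φ p u) (fderiv ℝ φ p v) = prodForm u v
  isEmbedding : Topology.IsEmbedding (U.domRestrict φ)

/-- There is a symplectic embedding of the subset `A` into the subset `B`. As usual for a set `A`
that need not be open, such an embedding is the restriction to `A` of a symplectic embedding of an
open neighbourhood of `A`; if `A` is open, the neighbourhood may be taken to be `A` itself. -/
def SymplecticallyEmbeds {a b c d : ℕ} (A : Set (R2 a × R2 b)) (B : Set (R2 c × R2 d)) : Prop :=
  ∃ (U : Set (R2 a × R2 b)) (φ : R2 a × R2 b → R2 c × R2 d),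
    A ⊆ U ∧ IsSymplecticEmbeddingOn φ U ∧ Set.MapsTo φ A B

/-! In polar action-angle coordinates the ball `B⁴(R)` is `s₁ + s₂ < R² / 2`. A disc of radius `ρ`
slightly above 1 becomes, slice by slice, the rectangle `(0, ρ²/2) × (0, 2π)` in the coordinates
`(s₁, t₁)`. The `(x₂, y₂)`-strip is wound around a thin ellipse in the `(s₂, t₂)`-plane: an
area-preserving immersion whose turns overlap. Translating `x₃` by `A` per turn makes the turns
disjoint.

The translation is a step `χ(s₂)` on the side `cos < 0` of the ellipse, and symplecticity forces the
rotation `χ'(s₂) y₃` of `t₂`, which may sweep the whole circle and hit the other side. There, over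
the support of `χ'`, the first factor is therefore moved off itself by `c(s₂) = ρ²/2`. This move in
turn costs a rotation by `-c'(s₂) t₁`, where `t₁` spans `2π`; if `|c'| ≤ θ < 1`, then after the
correction `e` it fits, together with the thin ellipse, into one full turn, so the two sides still
do not meet.

Raising and lowering `c` with slope below 1 takes two intervals of `s₂` longer than `ρ²/2`. With the
`ρ²/2` occupied by `s₁` this needs three portions just above `1/2`, that is `R² > 3`. The parameters
come from `exists_wrappingData`, symplecticity from `wrap_pullback`, disjointness from `not_meet`
and `wrap_injOn`. -/

/-! ### Smooth steps. -/

/-- A smooth step of height `α` across `[0, L]` whose slope stays below `θ`. -/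
lemma exists_smooth_step {α L θ : ℝ} (hα : 0 < α) (hθ : 0 < θ) (h : α < θ * L) :
    ∃ P : ℝ → ℝ, ContDiff ℝ ∞ P ∧ (∀ s ≤ 0, P s = 0) ∧ (∀ s, L ≤ s → P s = α) ∧
      ∀ s, 0 ≤ deriv P s ∧ deriv P s ≤ θ := by
  have hL : 0 < L := by
    by_contra hL
    nlinarith [mul_nonneg hθ.le (sub_nonneg.2 (not_lt.1 hL))]
  have hα' : α / θ < L := by rwa [div_lt_iff₀ hθ, mul_comm]
  -- The bump equals 1 on an interval of length `α / θ`, so its integral `I` is at least `α / θ`,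
  -- and the primitive rescaled to height `α` has slope at most `α / I ≤ θ`.
  let f : ContDiffBump (L / 2) := ⟨α / θ / 2, L / 2, by positivity, by linarith⟩
  have hfc : Continuous f := f.continuous
  have hfi : ∀ a b, IntervalIntegrable f MeasureTheory.volume a b :=
    fun a b => hfc.intervalIntegrable a b
  have hf0 : ∀ s, s ≤ 0 → f s = 0 := fun s hs => f.zero_of_le_dist (by
    rw [Real.dist_eq, abs_of_nonpos (by linarith)]; change L / 2 ≤ _; linarith)
  have hfL : ∀ s, L ≤ s → f s = 0 := fun s hs => f.zero_of_le_dist (by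
    rw [Real.dist_eq, abs_of_nonneg (by linarith)]; change L / 2 ≤ _; linarith)
  set I := ∫ s in (0 : ℝ)..L, f s with hI
  have hIge : α / θ ≤ I := by
    have h1 : ∫ s in (L / 2 - α / θ / 2)..(L / 2 + α / θ / 2), f s = α / θ := by
      have : ∫ s in (L / 2 - α / θ / 2)..(L / 2 + α / θ / 2), f s =
          ∫ s in (L / 2 - α / θ / 2)..(L / 2 + α / θ / 2), (1 : ℝ) := by
        refine intervalIntegral.integral_congr fun s hs => f.one_of_mem_closedBall ?_
        rw [Set.uIcc_of_le (by linarith [div_pos hα hθ])] at hs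
        rw [Real.closedBall_eq_Icc]; exact hs
      rw [this]; simp
    rw [← h1]
    exact intervalIntegral.integral_mono_interval (by linarith) (by linarith [div_pos hα hθ])
      (by linarith) (Filter.Eventually.of_forall fun s => f.nonneg) (hfi _ _)
  have hIpos : 0 < I := lt_of_lt_of_le (by positivity) hIge
  have hd : ∀ s, HasDerivAt (fun s => α / I * ∫ u in (0 : ℝ)..s, f u) (α / I * f s) s :=
    fun s => (intervalIntegral.integral_hasDerivAt_right (hfi _ _)
      (hfc.stronglyMeasurableAtFilter _ _) hfc.continuousAt).const_mul _
  have hderiv : deriv (fun s => α / I * ∫ u in (0 : ℝ)..s, f u) = fun s => α / I * f s :=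
    funext fun s => (hd s).deriv
  refine ⟨fun s => α / I * ∫ u in (0 : ℝ)..s, f u, ?_, ?_, ?_, ?_⟩
  · rw [contDiff_infty_iff_deriv, hderiv]
    exact ⟨fun s => (hd s).differentiableAt, contDiff_const.mul f.contDiff⟩
  · intro s hs
    have : ∫ u in (0 : ℝ)..s, f u = ∫ u in (0 : ℝ)..s, (0 : ℝ) := by
      refine intervalIntegral.integral_congr fun u hu => hf0 u ?_
      rw [Set.uIcc_of_ge hs] at hu
      exact hu.2
    simp [this]
  · intro s hs
    have : ∫ u in L..s, f u = ∫ u in L..s, (0 : ℝ) := by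
      refine intervalIntegral.integral_congr fun u hu => hfL u ?_
      rw [Set.uIcc_of_le hs] at hu
      exact hu.1
    have h2 := intervalIntegral.integral_add_adjacent_intervals (hfi 0 L) (hfi L s)
    simp only [this, intervalIntegral.integral_zero, add_zero] at h2
    simp only [← h2, ← hI]
    field_simp
  · intro s
    rw [hderiv]
    have h1 : α / I ≤ θ := by
      rw [div_le_iff₀ hIpos]
      rw [div_le_iff₀ hθ] at hIge
      linarith
    exact ⟨mul_nonneg (by positivity) f.nonneg,
      (mul_le_of_le_one_right (by positivity) f.le_one).trans h1⟩

/-! ### Slice coordinates on the disc. -/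

/-- The area of the part of the disc of radius `ρ` to the left of abscissa `u`, divided by `2π`. -/
noncomputable def sliceArea (ρ u : ℝ) : ℝ :=
  (u * √(ρ ^ 2 - u ^ 2) + ρ ^ 2 * Real.arcsin (u / ρ)) / (2 * Real.pi) + ρ ^ 2 / 4

/-- Area grows at the rate of the chord length `2 √(ρ² - u²)`, here divided by `2π`. -/
lemma hasDerivAt_sliceArea {ρ u : ℝ} (hρ : 0 < ρ) (hu : u ^ 2 < ρ ^ 2) :
    HasDerivAt (sliceArea ρ) (√(ρ ^ 2 - u ^ 2) / Real.pi) u := by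
  have hab := abs_lt_of_sq_lt_sq' hu hρ.le
  have h1 : u / ρ ≠ -1 := by
    rw [Ne, div_eq_iff hρ.ne']; intro h; linarith [hab.1]
  have h2 : u / ρ ≠ 1 := by
    rw [Ne, div_eq_iff hρ.ne']; intro h; linarith [hab.2]
  have hpos : 0 < ρ ^ 2 - u ^ 2 := by linarith
  have hs : 0 < √(ρ ^ 2 - u ^ 2) := Real.sqrt_pos.2 hpos
  have hsq : √(1 - (u / ρ) ^ 2) = √(ρ ^ 2 - u ^ 2) / ρ := by
    rw [show 1 - (u / ρ) ^ 2 = (ρ ^ 2 - u ^ 2) / ρ ^ 2 by field_simp, Real.sqrt_div hpos.le,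
      Real.sqrt_sq hρ.le]
  have ha : HasDerivAt (fun u => Real.arcsin (u / ρ)) (1 / √(1 - (u / ρ) ^ 2) * (1 / ρ)) u :=
    (Real.hasDerivAt_arcsin h1 h2).comp (h := fun u => u / ρ) u ((hasDerivAt_id u).div_const ρ)
  have hb : HasDerivAt (fun u => √(ρ ^ 2 - u ^ 2)) (-(2 * u) / (2 * √(ρ ^ 2 - u ^ 2))) u := by
    have := ((hasDerivAt_pow 2 u).const_sub (ρ ^ 2)).sqrt hpos.ne'
    simpa using this
  have := ((((hasDerivAt_id u).mul hb).add (ha.const_mul (ρ ^ 2))).div_const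
    (2 * Real.pi)).add_const (ρ ^ 2 / 4)
  refine this.congr_deriv ?_
  rw [hsq]
  have hs2 : √(ρ ^ 2 - u ^ 2) ^ 2 = ρ ^ 2 - u ^ 2 := Real.sq_sqrt hpos.le
  simp only [id]
  field_simp
  linear_combination -hs2

lemma contDiffAt_sliceArea {ρ u : ℝ} (hρ : 0 < ρ) (hu : u ^ 2 < ρ ^ 2) :
    ContDiffAt ℝ ∞ (sliceArea ρ) u := by
  have hab := abs_lt_of_sq_lt_sq' hu hρ.le
  have h1 : u / ρ ≠ -1 := by
    rw [Ne, div_eq_iff hρ.ne']; intro h; linarith [hab.1]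
  have h2 : u / ρ ≠ 1 := by
    rw [Ne, div_eq_iff hρ.ne']; intro h; linarith [hab.2]
  have hpos : ρ ^ 2 - u ^ 2 ≠ 0 := by linarith
  have ha : ContDiffAt ℝ ∞ (fun u => Real.arcsin (u / ρ)) u :=
    (Real.contDiffAt_arcsin h1 h2).comp (f := fun u => u / ρ) u (contDiffAt_id.div_const ρ)
  have hb : ContDiffAt ℝ ∞ (fun u => √(ρ ^ 2 - u ^ 2)) u :=
    (contDiffAt_const.sub (contDiffAt_id.pow 2)).sqrt hpos
  exact (((contDiffAt_id.mul hb).add (contDiffAt_const.mul ha)).div_const _).add contDiffAt_const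

lemma strictMonoOn_sliceArea {ρ : ℝ} (hρ : 0 < ρ) :
    StrictMonoOn (sliceArea ρ) (Set.Icc (-ρ) ρ) := by
  refine strictMonoOn_of_deriv_pos (convex_Icc _ _) ?_ fun x hx => ?_
  · unfold sliceArea
    have := Real.continuous_arcsin
    fun_prop
  · rw [interior_Icc] at hx
    have hx2 : x ^ 2 < ρ ^ 2 := sq_lt_sq' hx.1 hx.2
    rw [(hasDerivAt_sliceArea hρ hx2).deriv]
    have : 0 < √(ρ ^ 2 - x ^ 2) := Real.sqrt_pos.2 (by linarith)
    positivity

lemma sliceArea_mem_Ioo {ρ u : ℝ} (hρ : 0 < ρ) (hu : u ^ 2 < ρ ^ 2) :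
    sliceArea ρ u ∈ Set.Ioo 0 (ρ ^ 2 / 2) := by
  have hab := abs_lt_of_sq_lt_sq' hu hρ.le
  have hmono := strictMonoOn_sliceArea hρ
  have hl : sliceArea ρ (-ρ) = 0 := by
    simp only [sliceArea, neg_div, div_self hρ.ne', Real.arcsin_neg, Real.arcsin_one]
    simp
    field_simp
    ring
  have hr : sliceArea ρ ρ = ρ ^ 2 / 2 := by
    simp only [sliceArea, div_self hρ.ne', Real.arcsin_one]
    simp
    field_simp
    ring
  constructor
  · rw [← hl]
    exact hmono ⟨le_rfl, by linarith⟩ ⟨hab.1.le, hab.2.le⟩ hab.1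
  · rw [← hr]
    exact hmono ⟨hab.1.le, hab.2.le⟩ ⟨by linarith, le_rfl⟩ hab.2

/-! ### Area preservation of the building blocks. -/

section Wedge

variable {E : Type*} [NormedAddCommGroup E] [NormedSpace ℝ E]

/-- The value of the two-form `df ∧ dg` at the point `p` on the vectors `u`, `v`. -/
noncomputable def wedge (f g : E → ℝ) (p u v : E) : ℝ :=
  fderiv ℝ f p u * fderiv ℝ g p v - fderiv ℝ g p u * fderiv ℝ f p v

lemma wedge_congr {f f' g g' : E → ℝ} {p : E} (hf : f =ᶠ[nhds p] f') (hg : g =ᶠ[nhds p] g')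
    (u v : E) : wedge f g p u v = wedge f' g' p u v := by
  simp only [wedge, hf.fderiv_eq, hg.fderiv_eq]

/-- Symplectic polar coordinates preserve area. -/
lemma wedge_polar {s t : E → ℝ} {p : E} (hs : DifferentiableAt ℝ s p)
    (ht : DifferentiableAt ℝ t p) (h0 : 0 < s p) (u v : E) :
    wedge (fun q => √(2 * s q) * Real.cos (t q)) (fun q => √(2 * s q) * Real.sin (t q)) p u v =
      wedge s t p u v := by
  have hr := (hs.hasFDerivAt.const_mul 2).sqrt (by positivity)
  have hc := hr.mul ht.hasFDerivAt.cos
  have hn := hr.mul ht.hasFDerivAt.sin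
  have hp : √(2 * s p) ≠ 0 := (Real.sqrt_pos.2 (by positivity)).ne'
  have e1 : fderiv ℝ (fun q => √(2 * s q) * Real.cos (t q)) p = _ := hc.fderiv
  have e2 : fderiv ℝ (fun q => √(2 * s q) * Real.sin (t q)) p = _ := hn.fderiv
  simp only [wedge, e1, e2]
  generalize √(2 * s p) = r at hp ⊢
  simp
  field_simp
  linear_combination r ^ 2 * (fderiv ℝ s p u * fderiv ℝ t p v - fderiv ℝ t p u * fderiv ℝ s p v) *
    Real.sin_sq_add_cos_sq (t p)

/-- Straightening the vertical slices of a disc preserves area. -/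
lemma wedge_slice {ρ : ℝ} (hρ : 0 < ρ) {x y : E → ℝ} {p : E} (hx : DifferentiableAt ℝ x p)
    (hy : DifferentiableAt ℝ y p) (h : x p ^ 2 < ρ ^ 2) (u v : E) :
    wedge (fun q => sliceArea ρ (x q))
      (fun q => y q * Real.pi / √(ρ ^ 2 - x q ^ 2) + Real.pi) p u v = wedge x y p u v := by
  have hpos : 0 < ρ ^ 2 - x p ^ 2 := by linarith
  have hp : √(ρ ^ 2 - x p ^ 2) ≠ 0 := (Real.sqrt_pos.2 hpos).ne'
  have h1 := (hasDerivAt_sliceArea hρ h).comp_hasFDerivAt p hx.hasFDerivAt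
  have h2 := ((hx.hasFDerivAt.pow 2).const_sub (ρ ^ 2)).sqrt hpos.ne'
  have h2' : HasFDerivAt (fun q => (√(ρ ^ 2 - x q ^ 2))⁻¹) _ p :=
    (hasDerivAt_inv hp).comp_hasFDerivAt p h2
  have h3 : HasFDerivAt (fun q => y q * Real.pi / √(ρ ^ 2 - x q ^ 2) + Real.pi) _ p :=
    ((hy.hasFDerivAt.mul_const Real.pi).mul h2').add_const Real.pi
  simp only [wedge, h3.fderiv]
  rw [show (fun q => sliceArea ρ (x q)) = sliceArea ρ ∘ x from rfl, h1.fderiv]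
  simp
  field_simp
  ring

/-- Winding a strip around a thin ellipse preserves area. -/
lemma wedge_ellipse {m κ Λ q₀ : ℝ} (hκ : κ ≠ 0) (hΛ : Λ ≠ 0) {x y : E → ℝ} {p : E}
    (hx : DifferentiableAt ℝ x p) (hy : DifferentiableAt ℝ y p)
    (h : 0 < q₀ + 2 * y p / (Λ * κ)) (u v : E) :
    wedge (fun q => m + √(q₀ + 2 * y q / (Λ * κ)) * Real.sin (Λ * x q))
      (fun q => κ * (√(q₀ + 2 * y q / (Λ * κ)) * Real.cos (Λ * x q))) p u v = wedge x y p u v := by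
  have hr : HasFDerivAt (fun q => √(q₀ + 2 * y q / (Λ * κ))) _ p :=
    (((hy.hasFDerivAt.const_mul 2).mul_const (Λ * κ)⁻¹).const_add q₀).sqrt h.ne'
  have ha := hx.hasFDerivAt.const_mul Λ
  have h1 := (hr.mul ha.sin).const_add m
  have h2 := (hr.mul ha.cos).const_mul κ
  have hp : √(q₀ + 2 * y p / (Λ * κ)) ≠ 0 := (Real.sqrt_pos.2 h).ne'
  have e1 : fderiv ℝ (fun q => m + √(q₀ + 2 * y q / (Λ * κ)) * Real.sin (Λ * x q)) p = _ :=
    h1.fderiv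
  have e2 : fderiv ℝ (fun q => κ * (√(q₀ + 2 * y q / (Λ * κ)) * Real.cos (Λ * x q))) p = _ :=
    h2.fderiv
  simp only [wedge, e1, e2, ← div_eq_mul_inv]
  generalize √(q₀ + 2 * y p / (Λ * κ)) = r at hp ⊢
  simp
  field_simp
  linear_combination r ^ 2 * Λ ^ 2 * κ * (fderiv ℝ x p u * fderiv ℝ y p v - fderiv ℝ y p u * fderiv ℝ x p v) *
    Real.sin_sq_add_cos_sq (Λ * x p)

/-- The shear generated by the Hamiltonian `c(s₂) t₁ + d(s₂) y₃ - ∫ e(s₂)` is symplectic. -/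
lemma wedge_shear {c d e : ℝ → ℝ} (hc : ContDiff ℝ ∞ c) (hd : ContDiff ℝ ∞ d)
    (he : ContDiff ℝ ∞ e) {s₁ t₁ s₂ t₂ x y : E → ℝ} {p : E}
    (hs₁ : DifferentiableAt ℝ s₁ p) (ht₁ : DifferentiableAt ℝ t₁ p)
    (hs₂ : DifferentiableAt ℝ s₂ p) (ht₂ : DifferentiableAt ℝ t₂ p)
    (hx : DifferentiableAt ℝ x p) (hy : DifferentiableAt ℝ y p) (u v : E) :
    wedge (fun q => s₁ q + c (s₂ q)) t₁ p u v +
      wedge s₂ (fun q => t₂ q + (-deriv c (s₂ q) * t₁ q - deriv d (s₂ q) * y q + e (s₂ q))) p u v +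
      wedge (fun q => x q + d (s₂ q)) y p u v =
    wedge s₁ t₁ p u v + wedge s₂ t₂ p u v + wedge x y p u v := by
  have key : ∀ {g : ℝ → ℝ}, ContDiff ℝ ∞ g →
      HasFDerivAt (fun q => g (s₂ q)) (deriv g (s₂ p) • fderiv ℝ s₂ p) p := fun {g} hg =>
    ((hg.differentiable (by simp) _).hasDerivAt).comp_hasFDerivAt p hs₂.hasFDerivAt
  have hc' := (contDiff_infty_iff_deriv.1 hc).2
  have hd' := (contDiff_infty_iff_deriv.1 hd).2
  have h1 := hs₁.hasFDerivAt.add (key hc)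
  have h2 := hx.hasFDerivAt.add (key hd)
  have h3 := ht₂.hasFDerivAt.add
    ((((key hc').neg.mul ht₁.hasFDerivAt).sub ((key hd').mul hy.hasFDerivAt)).add (key he))
  have e1 : fderiv ℝ (fun q => s₁ q + c (s₂ q)) p = _ := h1.fderiv
  have e2 : fderiv ℝ (fun q => x q + d (s₂ q)) p = _ := h2.fderiv
  have e3 : fderiv ℝ (fun q => t₂ q + (-deriv c (s₂ q) * t₁ q - deriv d (s₂ q) * y q + e (s₂ q))) p
    = _ := h3.fderiv
  simp only [wedge, e1, e2, e3]
  simp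
  ring

end Wedge

/-! ### From injective symplectic maps to embeddings. -/

lemma stdForm_single_inr {n : ℕ} (u : R2 n) (i : Fin n) :
    stdForm u (EuclideanSpace.single (Sum.inr i) 1) = u (Sum.inl i) := by
  simp [stdForm]

lemma stdForm_single_inl {n : ℕ} (u : R2 n) (i : Fin n) :
    stdForm u (EuclideanSpace.single (Sum.inl i) 1) = -u (Sum.inr i) := by
  simp [stdForm]

lemma stdForm_zero_left {n : ℕ} (v : R2 n) : stdForm 0 v = 0 := by simp [stdForm]

lemma stdForm_zero_right {n : ℕ} (v : R2 n) : stdForm v 0 = 0 := by simp [stdForm]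

lemma eq_zero_of_stdForm_eq_zero {n : ℕ} {u : R2 n} (h : ∀ v, stdForm u v = 0) : u = 0 := by
  ext i
  cases i with
  | inl i => simpa [stdForm_single_inr] using h (EuclideanSpace.single (Sum.inr i) 1)
  | inr i => simpa [stdForm_single_inl] using h (EuclideanSpace.single (Sum.inl i) 1)

/-- The standard symplectic form is nondegenerate. -/
lemma eq_zero_of_prodForm_eq_zero {a b : ℕ} {u : R2 a × R2 b} (h : ∀ v, prodForm u v = 0) :
    u = 0 := by
  refine Prod.ext (eq_zero_of_stdForm_eq_zero fun v => ?_) (eq_zero_of_stdForm_eq_zero fun v => ?_)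
  · simpa [prodForm, stdForm_zero_right] using h (v, 0)
  · simpa [prodForm, stdForm_zero_right] using h (0, v)

/-- An injective symplectic map between open subsets of spaces of equal dimension is an
embedding. -/
lemma IsSymplecticEmbeddingOn.of_injOn {a b c d : ℕ} (hdim : a + b = c + d)
    {φ : R2 a × R2 b → R2 c × R2 d} {U : Set (R2 a × R2 b)} (hU : IsOpen U)
    (hφ : ∀ p ∈ U, ContDiffAt ℝ ∞ φ p)
    (hω : ∀ p ∈ U, ∀ u v, prodForm (fderiv ℝ φ p u) (fderiv ℝ φ p v) = prodForm u v)
    (hinj : Set.InjOn φ U) : IsSymplecticEmbeddingOn φ U := by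
  have hcd : ContDiffOn ℝ ∞ φ U := fun p hp => (hφ p hp).contDiffWithinAt
  refine ⟨hU, hcd, hω, ?_⟩
  -- Nondegeneracy makes the derivative injective, hence surjective by dimension, so `φ` is open at
  -- each point.
  have hmap : ∀ p ∈ U, Filter.map φ (nhds p) = nhds (φ p) := by
    intro p hp
    have hs : HasStrictFDerivAt φ (fderiv ℝ φ p) p :=
      (hφ p hp).hasStrictFDerivAt (by simp)
    have hi : Function.Injective (fderiv ℝ φ p : R2 a × R2 b →ₗ[ℝ] R2 c × R2 d) := by
      rw [← LinearMap.ker_eq_bot, LinearMap.ker_eq_bot']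
      intro u hu
      refine eq_zero_of_prodForm_eq_zero fun v => ?_
      rw [← hω p hp u v, show fderiv ℝ φ p u = 0 from hu]
      simp [prodForm, stdForm_zero_left]
    have hsurj := (LinearMap.injective_iff_surjective_of_finrank_eq_finrank (by
      simp only [Module.finrank_prod, finrank_euclideanSpace, Fintype.card_sum, Fintype.card_fin]
      omega)).1 hi
    exact hs.map_nhds_eq_of_surj (LinearMap.range_eq_top.2 hsurj)
  refine (Topology.IsOpenEmbedding.of_continuous_injective_isOpenMap
    (continuousOn_iff_continuous_domRestrict.1 hcd.continuousOn)
    (Set.injOn_iff_injective.1 hinj) ?_).isEmbedding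
  rw [isOpenMap_iff_nhds_le]
  intro p
  rw [show U.domRestrict φ = φ ∘ Subtype.val from rfl, ← Filter.map_map,
    map_nhds_subtype_coe_eq_nhds p.2 (hU.mem_nhds p.2), hmap p p.2]
  rfl

/-! ### Choice of the parameters. -/

/-- The parameters of the wrapping construction. Here `c` is the displacement of the first factor,
`e` a correction of the induced rotation, `χ` a step of height `A`; the strip is wound around the
ellipse with centre `(m, 0)`, and the cut-off functions vary only above `[lo, 2 * m - lo]`. -/
structure WrappingData (R T : ℝ) where
  (ρ m κ Λ q₀ A lo : ℝ)
  (c e χ : ℝ → ℝ)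
  one_lt_ρ : 1 < ρ
  κ_pos : 0 < κ
  Λ_pos : 0 < Λ
  lo_pos : 0 < lo
  lo_lt : lo < m
  two_mul_lt_A : 2 * T < A
  contDiff_c : ContDiff ℝ ∞ c
  contDiff_e : ContDiff ℝ ∞ e
  contDiff_χ : ContDiff ℝ ∞ χ
  radius : ∀ y, |y| < T → (m - lo) ^ 2 < q₀ + 2 * y / (Λ * κ) ∧ q₀ + 2 * y / (Λ * κ) < m ^ 2
  c_nonneg : ∀ s, 0 ≤ c s
  c_left : ∀ s < lo, c s = 0
  c_right : ∀ s, 2 * m - lo < s → c s = 0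
  e_left : ∀ s < lo, e s = 0
  e_right : ∀ s, 2 * m - lo < s → e s = 0
  χ_left : ∀ s < lo, χ s = 0
  χ_right : ∀ s, 2 * m - lo < s → χ s = A
  rotation : ∀ s, ∀ t ∈ Set.Ioo 0 (2 * Real.pi),
    0 ≤ -deriv c s * t + e s ∧ -deriv c s * t + e s + 2 * (κ * m) < 2 * Real.pi
  displaced : ∀ s, deriv χ s ≠ 0 → c s = ρ ^ 2 / 2
  add_c_le : ∀ s < 2 * m, ρ ^ 2 / 2 + (s + c s) ≤ R ^ 2 / 2

lemma deriv_eq_zero_of_forall_lt {f : ℝ → ℝ} {a b s : ℝ} (h : ∀ x < a, f x = b) (hs : s < a) :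
    deriv f s = 0 := by
  have : f =ᶠ[nhds s] fun _ => b := by
    filter_upwards [Iio_mem_nhds hs] with x hx using h x hx
  rw [this.deriv_eq, deriv_const]

lemma deriv_eq_zero_of_forall_gt {f : ℝ → ℝ} {a b s : ℝ} (h : ∀ x, a < x → f x = b) (hs : a < s) :
    deriv f s = 0 := by
  have : f =ᶠ[nhds s] fun _ => b := by
    filter_upwards [Ioi_mem_nhds hs] with x hx using h x hx
  rw [this.deriv_eq, deriv_const]

lemma exists_wrappingData {R T : ℝ} (hR : √3 < R) (hT : 0 < T) : Nonempty (WrappingData R T) := by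
  have hR2 : 3 < R ^ 2 := (Real.sqrt_lt' (lt_of_le_of_lt (Real.sqrt_nonneg 3) hR)).1 hR
  -- The slack `g` pays for all margins: the total action `a + 2 * m = a + 3 * h + 2 * L` equals `3
  -- / 2 + 11 * g / 12`.
  obtain ⟨g, hg⟩ : ∃ g, g = R ^ 2 / 2 - 3 / 2 := ⟨_, rfl⟩
  have hg0 : 0 < g := by linarith
  obtain ⟨a, ha⟩ : ∃ a, a = 1 / 2 + g / 12 := ⟨_, rfl⟩
  obtain ⟨L, hL⟩ : ∃ L, L = a + g / 12 := ⟨_, rfl⟩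
  obtain ⟨h, hh⟩ : ∃ h, h = g / 6 := ⟨_, rfl⟩
  have ha0 : 0 < a := by linarith
  have hL0 : 0 < L := by linarith
  have hh0 : 0 < h := by linarith
  obtain ⟨θ, hθ⟩ : ∃ θ, θ = (a / L + 1) / 2 := ⟨_, rfl⟩
  have haL : a / L < 1 := by rw [div_lt_one hL0]; linarith
  have hθ0 : 0 < θ := by have := div_pos ha0 hL0; linarith
  have hθ1 : θ < 1 := by linarith
  have haθ : a < θ * L := by rw [← div_lt_iff₀ hL0]; linarith
  obtain ⟨P, hP, hP0, hPL, hP'⟩ := exists_smooth_step ha0 hθ0 haθ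
  have hA0 : 0 < 2 * T + 1 := by linarith
  -- The slope of `χ` is irrelevant; only its height and the interval where it varies matter.
  obtain ⟨χ, hχ, hχ0, hχL, -⟩ := exists_smooth_step (L := h) (θ := (2 * T + 2) / h) hA0
    (by positivity) (by rw [div_mul_cancel₀ _ hh0.ne']; linarith)
  have hPm : Monotone P :=
    monotone_of_deriv_nonneg (hP.differentiable (by simp)) fun s => (hP' s).1
  -- The width `2 * m` is margin `h`, rise `L` of `c`, plateau `h` (where `χ` steps), fall `L`,
  -- margin `h`.
  obtain ⟨m, hm⟩ : ∃ m, m = (3 * h + 2 * L) / 2 := ⟨_, rfl⟩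
  have hm0 : 0 < m := by linarith
  -- The rotation uses at most `2πθ`; the ellipse takes `2κm = π(1 - θ)`, half of what is left.
  obtain ⟨κ, hκ⟩ : ∃ κ, κ = Real.pi * (1 - θ) / (2 * m) := ⟨_, rfl⟩
  have hκ0 : 0 < κ := by
    rw [hκ]; have := Real.pi_pos; have : 0 < 1 - θ := by linarith
    positivity
  have hκm : κ * m = Real.pi * (1 - θ) / 2 := by rw [hκ]; field_simp
  obtain ⟨w, hw⟩ : ∃ w, w = m ^ 2 - (m - h) ^ 2 := ⟨_, rfl⟩
  have hw0 : 0 < w := by rw [hw]; nlinarith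
  -- With this frequency `|y| < T` corresponds exactly to squared radii between `(m - h)²` and `m²`.
  obtain ⟨Λ, hΛ⟩ : ∃ Λ, Λ = 4 * T / (κ * w) := ⟨_, rfl⟩
  have hΛ0 : 0 < Λ := by rw [hΛ]; positivity
  have hdP1 : ∀ b s, deriv (fun s => P (s - b)) s = deriv P (s - b) := fun b s =>
    deriv_comp_sub_const ..
  have hPb : ∀ b, ContDiff ℝ ∞ fun s => P (s - b) := fun b =>
    hP.comp (contDiff_id.sub contDiff_const)
  have hdPb : ∀ b s, DifferentiableAt ℝ (fun s => P (s - b)) s := fun b =>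
    (hPb b).differentiable (by simp)
  have hdc : ∀ s, deriv (fun s => P (s - h) - P (s - (2 * h + L))) s =
      deriv P (s - h) - deriv P (s - (2 * h + L)) := fun s => by
    rw [deriv_fun_sub (hdPb _ _) (hdPb _ _), hdP1, hdP1]
  have hρ : √(2 * a) ^ 2 / 2 = a := by rw [Real.sq_sqrt (by linarith)]; ring
  -- As `c' ≥ -θ > -1`, the sum `s + c s` is largest at the right end, where `c` vanishes: the
  -- displacement costs no action beyond `2 * m`.
  have hmono : Monotone fun s => s + (P (s - h) - P (s - (2 * h + L))) := by
    refine monotone_of_deriv_nonneg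
      (differentiable_id.add fun s => (hdPb _ _).sub (hdPb _ _)) fun s => ?_
    rw [deriv_fun_add differentiableAt_fun_id ((hdPb _ _).fun_sub (hdPb _ _)), hdc, deriv_id'']
    linarith [(hP' (s - h)).1, (hP' (s - (2 * h + L))).2]
  exact ⟨{
    ρ := √(2 * a), m := m, κ := κ, Λ := Λ, q₀ := (m ^ 2 + (m - h) ^ 2) / 2, A := 2 * T + 1, lo := h
    c := fun s => P (s - h) - P (s - (2 * h + L))
    -- On the rise this turns the negative rotation `-P' t` into `P' (2π - t) ≥ 0`; on the fall the
    -- rotation is already nonnegative.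
    e := fun s => 2 * Real.pi * deriv P (s - h)
    χ := fun s => χ (s - (h + L))
    one_lt_ρ := by rw [Real.lt_sqrt (by norm_num)]; linarith
    κ_pos := hκ0
    Λ_pos := hΛ0
    lo_pos := hh0
    lo_lt := by linarith
    two_mul_lt_A := by linarith
    contDiff_c := (hPb _).sub (hPb _)
    contDiff_e := contDiff_const.mul
      ((contDiff_infty_iff_deriv.1 hP).2.comp (contDiff_id.sub contDiff_const))
    contDiff_χ := hχ.comp (contDiff_id.sub contDiff_const)
    radius := by
      intro y hy
      have h1 : 2 * y / (Λ * κ) = y / T * (w / 2) := by rw [hΛ]; field_simp; ring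
      have h2 : |y / T| < 1 := by rwa [abs_div, abs_of_pos hT, div_lt_one hT]
      rw [abs_lt] at h2
      rw [h1]
      have h3 := mul_pos (sub_pos.2 h2.2) hw0
      have h4 := mul_pos (neg_lt_iff_pos_add.1 h2.1) hw0
      constructor <;> linarith
    c_nonneg := fun s => sub_nonneg.2 (hPm (by linarith))
    c_left := fun s hs => by
      simp only [hP0 (s - h) (by linarith), hP0 (s - (2 * h + L)) (by linarith), sub_zero]
    c_right := fun s hs => by
      simp only [hPL (s - h) (by linarith), hPL (s - (2 * h + L)) (by linarith), sub_self]
    e_left := fun s hs => by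
      simp only [deriv_eq_zero_of_forall_lt (fun x hx => hP0 x (le_of_lt hx)) (sub_neg.2 hs),
        mul_zero]
    e_right := fun s hs => by
      simp only [deriv_eq_zero_of_forall_gt (fun x hx => hPL x (le_of_lt hx))
        (show L < s - h by linarith), mul_zero]
    χ_left := fun s hs => hχ0 _ (by linarith)
    χ_right := fun s hs => hχL _ (by linarith)
    rotation := by
      intro s t ht
      rw [hdc, hκm]
      have h1 := hP' (s - h)
      have h2 := hP' (s - (2 * h + L))
      have ht1 : 0 < 2 * Real.pi - t := by linarith [ht.2]
      have e1 := mul_nonneg h1.1 ht1.le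
      have e2 := mul_nonneg h2.1 ht.1.le
      have e3 := mul_le_mul_of_nonneg_right h1.2 ht1.le
      have e4 := mul_le_mul_of_nonneg_right h2.2 ht.1.le
      have e5 := mul_pos Real.pi_pos (sub_pos.2 hθ1)
      constructor <;> linarith
    displaced := by
      intro s hs
      rw [deriv_comp_sub_const] at hs
      rw [hρ]
      have h1 : 0 ≤ s - (h + L) := by
        by_contra hlt
        exact hs (deriv_eq_zero_of_forall_lt (fun x hx => hχ0 x (le_of_lt hx)) (not_le.1 hlt))
      have h2 : s - (h + L) ≤ h := by
        by_contra hlt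
        exact hs (deriv_eq_zero_of_forall_gt (fun x hx => hχL x (le_of_lt hx)) (not_le.1 hlt))
      simp only [hPL (s - h) (by linarith), hP0 (s - (2 * h + L)) (by linarith), sub_zero]
    add_c_le := by
      intro s hs
      have := hmono hs.le
      simp only [hPL (2 * m - h) (by linarith), hPL (2 * m - (2 * h + L)) (by linarith)] at this
      rw [hρ]
      linarith }⟩

/-! ### Counting the turns. -/

/-- The number of the turn, started at angle `-π / 2`, to which the angle `X` belongs. -/
noncomputable def turnIndex (X : ℝ) : ℤ := ⌊(X + Real.pi / 2) / (2 * Real.pi)⌋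

lemma turnIndex_add_int_mul (X : ℝ) (j : ℤ) : turnIndex (X + j * (2 * Real.pi)) = turnIndex X + j := by
  have := Real.pi_pos
  rw [turnIndex, turnIndex, ← Int.floor_add_intCast]
  congr 1
  field_simp
  ring

lemma turnIndex_eq_of_mem {X : ℝ} {j : ℤ}
    (hX : X ∈ Set.Ico (j * (2 * Real.pi) - Real.pi / 2) ((j + 1) * (2 * Real.pi) - Real.pi / 2)) :
    turnIndex X = j := by
  have h : 0 < 2 * Real.pi := Real.two_pi_pos
  rw [turnIndex, Int.floor_eq_iff, le_div_iff₀ h, div_lt_iff₀ h]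
  constructor <;> linarith [hX.1, hX.2]

lemma eventually_turnIndex_eq {X₀ : ℝ} (h : Real.sin X₀ ≠ -1) :
    ∀ᶠ X in nhds X₀, turnIndex X = turnIndex X₀ := by
  have hpi : 0 < 2 * Real.pi := Real.two_pi_pos
  have h1 := Int.floor_le ((X₀ + Real.pi / 2) / (2 * Real.pi))
  have h2 := Int.lt_floor_add_one ((X₀ + Real.pi / 2) / (2 * Real.pi))
  change ((turnIndex X₀ : ℤ) : ℝ) ≤ _ at h1
  change _ < ((turnIndex X₀ : ℤ) : ℝ) + 1 at h2
  rw [le_div_iff₀ hpi] at h1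
  rw [div_lt_iff₀ hpi] at h2
  have h3 : turnIndex X₀ * (2 * Real.pi) - Real.pi / 2 < X₀ := by
    refine lt_of_le_of_ne (by linarith) fun h3 => h ?_
    rw [← h3, sub_eq_neg_add, Real.sin_add_int_mul_two_pi, Real.sin_neg, Real.sin_pi_div_two]
  filter_upwards [Ioo_mem_nhds h3 (show X₀ < (turnIndex X₀ + 1) * (2 * Real.pi) - Real.pi / 2 by
    linarith)] with X hX using turnIndex_eq_of_mem ⟨hX.1.le, hX.2⟩

/-- The index jumps by one at the bottom of the ellipse, and `cos < 0` just before the jump. The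
extra 1 on that side is the completed step `A - χ = A` in `shift₃`, so the translation is continuous
there. -/
lemma exists_eventually_turnIndex_add_eq {X₀ : ℝ} (h : Real.sin X₀ = -1) :
    ∃ j : ℤ, ∀ᶠ X in nhds X₀, (Real.cos X < 0 → turnIndex X + 1 = j) ∧
      (¬ Real.cos X < 0 → turnIndex X = j) := by
  have hpi := Real.pi_pos
  obtain ⟨j, hj⟩ := Real.sin_eq_neg_one_iff.1 h
  refine ⟨j, ?_⟩
  filter_upwards [Ioo_mem_nhds (show X₀ - Real.pi < X₀ by linarith)
    (show X₀ < X₀ + Real.pi by linarith)] with X hX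
  have hcos : Real.cos X = Real.cos (X - j * (2 * Real.pi)) :=
    (Real.cos_sub_int_mul_two_pi X j).symm
  rcases lt_or_ge X X₀ with hlt | hge
  · have h1 : turnIndex X = j - 1 :=
      turnIndex_eq_of_mem (by push_cast; constructor <;> linarith [hX.1])
    have h2 : Real.cos X < 0 := by
      rw [hcos, ← Real.cos_neg]
      exact Real.cos_neg_of_pi_div_two_lt_of_lt (by linarith) (by linarith [hX.1])
    exact ⟨fun _ => by rw [h1]; ring, fun h3 => absurd h2 h3⟩
  · have h1 : turnIndex X = j :=
      turnIndex_eq_of_mem (by constructor <;> linarith [hX.2])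
    have h2 : 0 ≤ Real.cos X := by
      rw [hcos]
      exact Real.cos_nonneg_of_mem_Icc ⟨by linarith, by linarith [hX.2]⟩
    exact ⟨fun h3 => absurd h3 (not_lt.2 h2), fun _ => h1⟩

/-! ### The wrapping map and its bounds. -/

namespace WrappingData

open Real

variable {R T : ℝ} (D : WrappingData R T) {N : ℕ}

/-- The open neighbourhood of the product of balls on which the wrapping map is defined. -/
def domain (N : ℕ) : Set (R2 1 × R2 (N + 2)) :=
  Metric.ball 0 D.ρ ×ˢ Metric.ball 0 T

/-- Action coordinate of the first factor. -/
noncomputable def s₁ (p : R2 1 × R2 (N + 2)) : ℝ := sliceArea D.ρ (p.1 (Sum.inl 0))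

/-- Angle coordinate of the first factor. -/
noncomputable def t₁ (p : R2 1 × R2 (N + 2)) : ℝ :=
  p.1 (Sum.inr 0) * π / √(D.ρ ^ 2 - p.1 (Sum.inl 0) ^ 2) + π

/-- Position of a point of the strip along the ellipse. -/
noncomputable def angle (p : R2 1 × R2 (N + 2)) : ℝ := D.Λ * p.2 (Sum.inl 0)

/-- Size of the ellipse on which a point of the strip is placed. -/
noncomputable def ellipseRadius (p : R2 1 × R2 (N + 2)) : ℝ :=
  √(D.q₀ + 2 * p.2 (Sum.inr 0) / (D.Λ * D.κ))

/-- Action coordinate of the second factor. -/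
noncomputable def s₂ (p : R2 1 × R2 (N + 2)) : ℝ := D.m + D.ellipseRadius p * sin (D.angle p)

/-- Angle coordinate of the second factor, before the shear. -/
noncomputable def t₂ (p : R2 1 × R2 (N + 2)) : ℝ := D.κ * (D.ellipseRadius p * cos (D.angle p))

open Classical in
/-- Displacement of the first factor. -/
noncomputable def shift₁ (p : R2 1 × R2 (N + 2)) : ℝ :=
  if cos (D.angle p) < 0 then 0 else D.c (D.s₂ p)

open Classical in
/-- Rotation of the second factor. -/
noncomputable def rotate₂ (p : R2 1 × R2 (N + 2)) : ℝ :=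
  if cos (D.angle p) < 0 then deriv D.χ (D.s₂ p) * p.2 (Sum.inr 1)
  else -deriv D.c (D.s₂ p) * D.t₁ p + D.e (D.s₂ p)

open Classical in
/-- Translation of the third factor, which separates the turns. -/
noncomputable def shift₃ (p : R2 1 × R2 (N + 2)) : ℝ :=
  D.A * turnIndex (D.angle p) + if cos (D.angle p) < 0 then D.A - D.χ (D.s₂ p) else 0

/-- The wrapping map. -/
noncomputable def wrap (p : R2 1 × R2 (N + 2)) : R2 2 × R2 (N + 1) :=
  (WithLp.toLp 2 (Sum.elim
      ![√(2 * (D.s₁ p + D.shift₁ p)) * cos (D.t₁ p), √(2 * D.s₂ p) * cos (D.t₂ p + D.rotate₂ p)]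
      ![√(2 * (D.s₁ p + D.shift₁ p)) * sin (D.t₁ p), √(2 * D.s₂ p) * sin (D.t₂ p + D.rotate₂ p)]),
    WithLp.toLp 2 (Sum.elim
      (Fin.cons (p.2 (Sum.inl 1) + D.shift₃ p) fun j => p.2 (Sum.inl j.succ.succ))
      (Fin.cons (p.2 (Sum.inr 1)) fun j => p.2 (Sum.inr j.succ.succ))))

lemma ρ_pos : 0 < D.ρ := one_pos.trans D.one_lt_ρ

lemma m_pos : 0 < D.m := D.lo_pos.trans D.lo_lt

variable {D} {p : R2 1 × R2 (N + 2)}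

lemma sq_add_sq_lt (hp : p ∈ D.domain N) : p.1 (Sum.inl 0) ^ 2 + p.1 (Sum.inr 0) ^ 2 < D.ρ ^ 2 := by
  have h : ‖p.1‖ < D.ρ := by simpa [domain] using hp.1
  have h2 := pow_lt_pow_left₀ h (norm_nonneg _) two_ne_zero
  rw [EuclideanSpace.norm_sq_eq] at h2
  simpa using h2

lemma abs_snd_lt (hp : p ∈ D.domain N) (i : Fin (N + 2) ⊕ Fin (N + 2)) : |p.2 i| < T := by
  have h : ‖p.2‖ < T := by simpa [domain] using hp.2
  exact (PiLp.norm_apply_le p.2 i).trans_lt h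

lemma inl_sq_lt (hp : p ∈ D.domain N) : p.1 (Sum.inl 0) ^ 2 < D.ρ ^ 2 := by
  nlinarith [sq_add_sq_lt hp, sq_nonneg (p.1 (Sum.inr 0))]

lemma s₁_mem (hp : p ∈ D.domain N) : D.s₁ p ∈ Set.Ioo 0 (D.ρ ^ 2 / 2) :=
  sliceArea_mem_Ioo D.ρ_pos (inl_sq_lt hp)

lemma t₁_mem (hp : p ∈ D.domain N) : D.t₁ p ∈ Set.Ioo 0 (2 * π) := by
  have h := sq_add_sq_lt hp
  have hs : 0 < √(D.ρ ^ 2 - p.1 (Sum.inl 0) ^ 2) := Real.sqrt_pos.2 (by linarith [inl_sq_lt hp])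
  have h1 : |p.1 (Sum.inr 0) / √(D.ρ ^ 2 - p.1 (Sum.inl 0) ^ 2)| < 1 := by
    rw [abs_div, abs_of_pos hs, div_lt_one hs]
    exact Real.lt_sqrt_of_sq_lt (by rw [sq_abs]; linarith)
  rw [abs_lt] at h1
  have hpi := pi_pos
  rw [t₁, mul_div_right_comm]
  constructor <;> nlinarith

lemma radicand_bounds (hp : p ∈ D.domain N) : (D.m - D.lo) ^ 2 < D.q₀ + 2 * p.2 (Sum.inr 0) / (D.Λ * D.κ) ∧
    D.q₀ + 2 * p.2 (Sum.inr 0) / (D.Λ * D.κ) < D.m ^ 2 := D.radius _ (abs_snd_lt hp _)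

lemma radicand_pos (hp : p ∈ D.domain N) : 0 < D.q₀ + 2 * p.2 (Sum.inr 0) / (D.Λ * D.κ) :=
  (sq_nonneg _).trans_lt (radicand_bounds hp).1

lemma radius_bounds (hp : p ∈ D.domain N) : D.m - D.lo < D.ellipseRadius p ∧ D.ellipseRadius p < D.m :=
  ⟨Real.lt_sqrt_of_sq_lt (radicand_bounds hp).1,
    (Real.sqrt_lt' D.m_pos).2 (radicand_bounds hp).2⟩

lemma radius_pos (hp : p ∈ D.domain N) : 0 < D.ellipseRadius p := Real.sqrt_pos.2 (radicand_pos hp)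

lemma s₂_mem (hp : p ∈ D.domain N) : D.s₂ p ∈ Set.Ioo 0 (2 * D.m) := by
  have h := radius_bounds hp
  have h0 := radius_pos hp
  have h1 := neg_one_le_sin (D.angle p)
  have h2 := sin_le_one (D.angle p)
  rw [s₂]
  constructor <;> nlinarith

lemma abs_t₂_lt (hp : p ∈ D.domain N) : |D.t₂ p| < D.κ * D.m := by
  have h := radius_bounds hp
  have h0 := radius_pos hp
  rw [t₂, abs_mul, abs_mul, abs_of_pos D.κ_pos, abs_of_pos h0]
  refine mul_lt_mul_of_pos_left ?_ D.κ_pos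
  exact (mul_le_of_le_one_right h0.le (abs_cos_le_one _)).trans_lt h.2

lemma shift₁_nonneg : 0 ≤ D.shift₁ p := by
  rw [shift₁]; split_ifs
  exacts [le_rfl, D.c_nonneg _]

lemma s₁_add_shift₁_pos (hp : p ∈ D.domain N) : 0 < D.s₁ p + D.shift₁ p :=
  add_pos_of_pos_of_nonneg (s₁_mem hp).1 shift₁_nonneg

lemma action_sum_lt (hp : p ∈ D.domain N) : D.s₁ p + D.shift₁ p + D.s₂ p < R ^ 2 / 2 := by
  have h1 := (s₁_mem hp).2
  have h2 := D.add_c_le _ (s₂_mem hp).2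
  have h3 : D.shift₁ p ≤ D.c (D.s₂ p) := by
    rw [shift₁]; split_ifs
    exacts [D.c_nonneg _, le_rfl]
  linarith

/-! ### Smoothness across the two ends of the ellipse. -/

lemma contDiffAt_s₁ (hp : p ∈ D.domain N) : ContDiffAt ℝ ∞ D.s₁ p :=
  (contDiffAt_sliceArea D.ρ_pos (inl_sq_lt hp)).comp
    (f := fun p : R2 1 × R2 (N + 2) => p.1 (Sum.inl 0)) p (by fun_prop)

lemma contDiffAt_t₁ (hp : p ∈ D.domain N) : ContDiffAt ℝ ∞ D.t₁ p := by
  have h : 0 < D.ρ ^ 2 - p.1 (Sum.inl 0) ^ 2 := by linarith [inl_sq_lt hp]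
  have h1 : ContDiffAt ℝ ∞ (fun p : R2 1 × R2 (N + 2) => √(D.ρ ^ 2 - p.1 (Sum.inl 0) ^ 2)) p :=
    ContDiffAt.sqrt (by fun_prop) h.ne'
  exact (ContDiffAt.div (by fun_prop) h1 (Real.sqrt_pos.2 h).ne').add contDiffAt_const

lemma contDiffAt_radius (hp : p ∈ D.domain N) : ContDiffAt ℝ ∞ D.ellipseRadius p :=
  ContDiffAt.sqrt (by fun_prop) (radicand_pos hp).ne'

lemma contDiffAt_angle : ContDiffAt ℝ ∞ D.angle p := by
  unfold angle
  fun_prop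

lemma contDiffAt_s₂ (hp : p ∈ D.domain N) : ContDiffAt ℝ ∞ D.s₂ p :=
  contDiffAt_const.add ((contDiffAt_radius hp).mul contDiffAt_angle.sin)

lemma contDiffAt_t₂ (hp : p ∈ D.domain N) : ContDiffAt ℝ ∞ D.t₂ p :=
  contDiffAt_const.mul ((contDiffAt_radius hp).mul contDiffAt_angle.cos)

/-- Near each point of the domain the shear has smooth coefficients. -/
lemma exists_smooth_shear (hp : p ∈ D.domain N) : ∃ c d e : ℝ → ℝ, ContDiff ℝ ∞ c ∧ ContDiff ℝ ∞ d ∧ ContDiff ℝ ∞ e ∧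
    ∀ᶠ q in nhds p, D.shift₁ q = c (D.s₂ q) ∧ D.shift₃ q = d (D.s₂ q) ∧
      D.rotate₂ q = -deriv c (D.s₂ q) * D.t₁ q - deriv d (D.s₂ q) * q.2 (Sum.inr 1)
        + e (D.s₂ q) := by
  have hang : ContinuousAt D.angle p := contDiffAt_angle.continuousAt
  have hs₂ : ContinuousAt D.s₂ p := (contDiffAt_s₂ hp).continuousAt
  have hcos : ContinuousAt (fun q => cos (D.angle q)) p :=
    Real.continuous_cos.continuousAt.comp hang
  have hr := radius_bounds hp
  rcases lt_trichotomy (cos (D.angle p)) 0 with hneg | hzero | hpos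
  · have hsin : sin (D.angle p) ≠ -1 := fun h => by
      have := sin_sq_add_cos_sq (D.angle p); rw [h] at this; nlinarith
    -- Here `d' = -χ'`, which produces the rotation `χ' y₃`.
    refine ⟨fun _ => 0, fun s => D.A * turnIndex (D.angle p) + (D.A - D.χ s), fun _ => 0,
      contDiff_const, contDiff_const.add (contDiff_const.sub D.contDiff_χ), contDiff_const, ?_⟩
    filter_upwards [hang.eventually (eventually_turnIndex_eq hsin),
      hcos.eventually (Iio_mem_nhds hneg)] with q hq hq'
    have hq' : cos (D.angle q) < 0 := hq'
    simp [shift₁, shift₃, rotate₂, hq, hq']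
  · have hsq : sin (D.angle p) ^ 2 = 1 := by
      have := sin_sq_add_cos_sq (D.angle p); rw [hzero] at this; linarith
    rcases mul_self_eq_one_iff.1 ((sq _).symm.trans hsq) with hsin | hsin
    -- At either end of the ellipse `s₂` lies in a margin where all cut-offs are constant, so the
    -- formulas for the two sides agree.
    · have hlt : 2 * D.m - D.lo < D.s₂ p := by rw [s₂, hsin]; linarith [hr.1]
      refine ⟨fun _ => 0, fun _ => D.A * turnIndex (D.angle p), fun _ => 0,
        contDiff_const, contDiff_const, contDiff_const, ?_⟩
      filter_upwards [hang.eventually (eventually_turnIndex_eq (by rw [hsin]; norm_num)),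
        hs₂.eventually (Ioi_mem_nhds hlt)] with q hq hq'
      have h1 : deriv D.χ (D.s₂ q) = 0 := deriv_eq_zero_of_forall_gt D.χ_right hq'
      have h2 : deriv D.c (D.s₂ q) = 0 := deriv_eq_zero_of_forall_gt D.c_right hq'
      simp [shift₁, shift₃, rotate₂, hq, h1, h2, D.c_right _ hq', D.e_right _ hq',
        D.χ_right _ hq']
    · have hlt : D.s₂ p < D.lo := by rw [s₂, hsin]; linarith [hr.1]
      obtain ⟨j, hj⟩ := exists_eventually_turnIndex_add_eq hsin
      refine ⟨fun _ => 0, fun _ => D.A * j, fun _ => 0,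
        contDiff_const, contDiff_const, contDiff_const, ?_⟩
      filter_upwards [hang.eventually hj, hs₂.eventually (Iio_mem_nhds hlt)] with q hq hq'
      have h1 : deriv D.χ (D.s₂ q) = 0 := deriv_eq_zero_of_forall_lt D.χ_left hq'
      have h2 : deriv D.c (D.s₂ q) = 0 := deriv_eq_zero_of_forall_lt D.c_left hq'
      by_cases h : cos (D.angle q) < 0
      · simp [shift₁, shift₃, rotate₂, ← hq.1 h, h, h1, D.χ_left _ hq']
        ring
      · simp [shift₁, shift₃, rotate₂, hq.2 h, h, h2, D.c_left _ hq', D.e_left _ hq']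
  · have hsin : sin (D.angle p) ≠ -1 := fun h => by
      have := sin_sq_add_cos_sq (D.angle p); rw [h] at this; nlinarith
    refine ⟨D.c, fun s => D.A * turnIndex (D.angle p), D.e,
      D.contDiff_c, contDiff_const, D.contDiff_e, ?_⟩
    filter_upwards [hang.eventually (eventually_turnIndex_eq hsin),
      hcos.eventually (Ioi_mem_nhds hpos)] with q hq hq'
    have hq' : ¬ cos (D.angle q) < 0 := not_lt.2 (le_of_lt hq')
    simp [shift₁, shift₃, rotate₂, hq, hq']

lemma contDiffAt_shift₁ (hp : p ∈ D.domain N) : ContDiffAt ℝ ∞ D.shift₁ p := by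
  obtain ⟨c, d, e, hc, hd, he, h⟩ := exists_smooth_shear hp
  exact (hc.contDiffAt.comp p (contDiffAt_s₂ hp)).congr_of_eventuallyEq (h.mono fun q hq => hq.1)

lemma contDiffAt_shift₃ (hp : p ∈ D.domain N) : ContDiffAt ℝ ∞ D.shift₃ p := by
  obtain ⟨c, d, e, hc, hd, he, h⟩ := exists_smooth_shear hp
  exact (hd.contDiffAt.comp p (contDiffAt_s₂ hp)).congr_of_eventuallyEq (h.mono fun q hq => hq.2.1)

lemma contDiffAt_rotate₂ (hp : p ∈ D.domain N) : ContDiffAt ℝ ∞ D.rotate₂ p := by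
  obtain ⟨c, d, e, hc, hd, he, h⟩ := exists_smooth_shear hp
  have hs₂ := contDiffAt_s₂ hp
  have key : ∀ {g : ℝ → ℝ}, ContDiff ℝ ∞ g → ContDiffAt ℝ ∞ (fun q => g (D.s₂ q)) p :=
    fun hg => hg.contDiffAt.comp p hs₂
  have hy : ContDiffAt ℝ ∞ (fun q : R2 1 × R2 (N + 2) => q.2 (Sum.inr 1)) p := by fun_prop
  exact ((((key (contDiff_infty_iff_deriv.1 hc).2).neg.mul (contDiffAt_t₁ hp)).sub
    ((key (contDiff_infty_iff_deriv.1 hd).2).mul hy)).add (key he)).congr_of_eventuallyEq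
    (h.mono fun q hq => hq.2.2)

lemma contDiffAt_wrap (hp : p ∈ D.domain N) : ContDiffAt ℝ ∞ D.wrap p := by
  have h₁ := (contDiffAt_const (c := (2 : ℝ))).mul ((contDiffAt_s₁ hp).add (contDiffAt_shift₁ hp))
  have hr₁ := h₁.sqrt (mul_pos two_pos (s₁_add_shift₁_pos hp)).ne'
  have h₂ := (contDiffAt_const (c := (2 : ℝ))).mul (contDiffAt_s₂ hp)
  have hr₂ := h₂.sqrt (mul_pos two_pos (s₂_mem hp).1).ne'
  have ht₁ := contDiffAt_t₁ hp
  have ht₂ := (contDiffAt_t₂ hp).add (contDiffAt_rotate₂ hp)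
  have h₃ := contDiffAt_shift₃ hp
  refine ContDiffAt.prodMk ?_ ?_
  · rw [contDiffAt_piLp]
    rintro (i | i) <;> fin_cases i
    exacts [hr₁.mul ht₁.cos, hr₂.mul ht₂.cos, hr₁.mul ht₁.sin, hr₂.mul ht₂.sin]
  · rw [contDiffAt_piLp]
    rintro (i | i) <;> refine Fin.cases ?_ (fun i => ?_) i
    · exact ContDiffAt.add (by fun_prop) h₃
    · simp only [Sum.elim_inl, Fin.cons_succ]; fun_prop
    · simp only [Sum.elim_inr, Fin.cons_zero]; fun_prop
    · simp only [Sum.elim_inr, Fin.cons_succ]; fun_prop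

/-! ### Symplecticity and the target ball. -/

/-- The map is the composite of slicing and winding, a shear, and polar coordinates; each preserves
the form by the corresponding `wedge` lemma, and the remaining coordinates are unchanged. -/
lemma wrap_pullback (hp : p ∈ D.domain N) (u v : R2 1 × R2 (N + 2)) :
    prodForm (fderiv ℝ D.wrap p u) (fderiv ℝ D.wrap p v) = prodForm u v := by
  have hd : DifferentiableAt ℝ D.wrap p := (contDiffAt_wrap hp).differentiableAt (by simp)
  have e1 : ∀ i w, (fderiv ℝ D.wrap p w).1 i = fderiv ℝ (fun q => (D.wrap q).1 i) p w := by
    intro i w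
    have := ((EuclideanSpace.proj i : R2 2 →L[ℝ] ℝ) ∘L
      ContinuousLinearMap.fst ℝ (R2 2) (R2 (N + 1))).hasFDerivAt.comp p hd.hasFDerivAt
    have h2 : fderiv ℝ (fun q => (D.wrap q).1 i) p = _ := this.fderiv
    rw [h2]; rfl
  have e2 : ∀ i w, (fderiv ℝ D.wrap p w).2 i = fderiv ℝ (fun q => (D.wrap q).2 i) p w := by
    intro i w
    have := ((EuclideanSpace.proj i : R2 (N + 1) →L[ℝ] ℝ) ∘L
      ContinuousLinearMap.snd ℝ (R2 2) (R2 (N + 1))).hasFDerivAt.comp p hd.hasFDerivAt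
    have h2 : fderiv ℝ (fun q => (D.wrap q).2 i) p = _ := this.fderiv
    rw [h2]; rfl
  have f1 : ∀ i w, fderiv ℝ (fun q : R2 1 × R2 (N + 2) => q.1 i) p w = w.1 i := fun i w =>
    DFunLike.congr_fun ((EuclideanSpace.proj i : R2 1 →L[ℝ] ℝ) ∘L
      ContinuousLinearMap.fst ℝ (R2 1) (R2 (N + 2))).hasFDerivAt.fderiv w
  have f2 : ∀ i w, fderiv ℝ (fun q : R2 1 × R2 (N + 2) => q.2 i) p w = w.2 i := fun i w =>
    DFunLike.congr_fun ((EuclideanSpace.proj i : R2 (N + 2) →L[ℝ] ℝ) ∘L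
      ContinuousLinearMap.snd ℝ (R2 1) (R2 (N + 2))).hasFDerivAt.fderiv w
  have hL : prodForm (fderiv ℝ D.wrap p u) (fderiv ℝ D.wrap p v) =
      wedge (fun q => √(2 * (D.s₁ q + D.shift₁ q)) * cos (D.t₁ q))
        (fun q => √(2 * (D.s₁ q + D.shift₁ q)) * sin (D.t₁ q)) p u v +
      wedge (fun q => √(2 * D.s₂ q) * cos (D.t₂ q + D.rotate₂ q))
        (fun q => √(2 * D.s₂ q) * sin (D.t₂ q + D.rotate₂ q)) p u v +
      wedge (fun q => q.2 (Sum.inl 1) + D.shift₃ q) (fun q => q.2 (Sum.inr 1)) p u v +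
      ∑ j : Fin N, (u.2 (Sum.inl j.succ.succ) * v.2 (Sum.inr j.succ.succ) -
        u.2 (Sum.inr j.succ.succ) * v.2 (Sum.inl j.succ.succ)) := by
    simp only [prodForm, stdForm, e1, e2]
    rw [Fin.sum_univ_two, Fin.sum_univ_succ]
    have g1 : ∀ (j : Fin N) w, fderiv ℝ (fun q => (D.wrap q).2 (Sum.inl j.succ)) p w =
        w.2 (Sum.inl j.succ.succ) := fun j w => f2 _ w
    have g2 : ∀ (j : Fin N) w, fderiv ℝ (fun q => (D.wrap q).2 (Sum.inr j.succ)) p w =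
        w.2 (Sum.inr j.succ.succ) := fun j w => f2 _ w
    simp only [g1, g2]
    rw [← add_assoc]
    rfl
  have hR : prodForm u v =
      wedge (fun q : R2 1 × R2 (N + 2) => q.1 (Sum.inl 0)) (fun q => q.1 (Sum.inr 0)) p u v +
      wedge (fun q : R2 1 × R2 (N + 2) => q.2 (Sum.inl 0)) (fun q => q.2 (Sum.inr 0)) p u v +
      wedge (fun q : R2 1 × R2 (N + 2) => q.2 (Sum.inl 1)) (fun q => q.2 (Sum.inr 1)) p u v +
      ∑ j : Fin N, (u.2 (Sum.inl j.succ.succ) * v.2 (Sum.inr j.succ.succ) -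
        u.2 (Sum.inr j.succ.succ) * v.2 (Sum.inl j.succ.succ)) := by
    simp only [prodForm, stdForm, wedge, f1, f2]
    rw [Fin.sum_univ_one, Fin.sum_univ_succ, Fin.sum_univ_succ]
    simp only [← add_assoc]
    rfl
  have ds₁ : DifferentiableAt ℝ D.s₁ p := (contDiffAt_s₁ hp).differentiableAt (by simp)
  have dt₁ : DifferentiableAt ℝ D.t₁ p := (contDiffAt_t₁ hp).differentiableAt (by simp)
  have ds₂ : DifferentiableAt ℝ D.s₂ p := (contDiffAt_s₂ hp).differentiableAt (by simp)
  have dt₂ : DifferentiableAt ℝ D.t₂ p := (contDiffAt_t₂ hp).differentiableAt (by simp)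
  have dh₁ : DifferentiableAt ℝ D.shift₁ p := (contDiffAt_shift₁ hp).differentiableAt (by simp)
  have dr₂ : DifferentiableAt ℝ D.rotate₂ p := (contDiffAt_rotate₂ hp).differentiableAt (by simp)
  have hslice : wedge D.s₁ D.t₁ p u v = _ :=
    wedge_slice (x := fun q : R2 1 × R2 (N + 2) => q.1 (Sum.inl 0))
      (y := fun q => q.1 (Sum.inr 0)) D.ρ_pos (by fun_prop) (by fun_prop) (inl_sq_lt hp) u v
  have hell : wedge D.s₂ D.t₂ p u v = _ :=
    wedge_ellipse (x := fun q : R2 1 × R2 (N + 2) => q.2 (Sum.inl 0))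
      (y := fun q => q.2 (Sum.inr 0)) D.κ_pos.ne' D.Λ_pos.ne' (by fun_prop) (by fun_prop)
      (radicand_pos hp) u v
  rw [hL, hR, wedge_polar (ds₁.fun_add dh₁) dt₁ (s₁_add_shift₁_pos hp),
    wedge_polar ds₂ (dt₂.fun_add dr₂) (s₂_mem hp).1, ← hslice, ← hell]
  obtain ⟨c, d, e, hc, hd, he, h⟩ := exists_smooth_shear hp
  rw [← wedge_shear hc hd he ds₁ dt₁ ds₂ dt₂ (by fun_prop) (by fun_prop) u v]
  congr 1
  congr 1
  · congr 1
    · exact wedge_congr (h.mono fun q hq => by simp only [hq.1]) (Filter.EventuallyEq.refl _ _) u v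
    · exact wedge_congr (Filter.EventuallyEq.refl _ _)
        (h.mono fun q hq => by simp only [hq.2.2]) u v
  · exact wedge_congr (h.mono fun q hq => by simp only [hq.2.1]) (Filter.EventuallyEq.refl _ _) u v

lemma wrap_mem_ball (hR : 0 < R) (hp : p ∈ D.domain N) : (D.wrap p).1 ∈ Metric.ball 0 R := by
  have h1 := s₁_add_shift₁_pos hp
  have h2 := (s₂_mem hp).1
  have h3 := action_sum_lt hp
  rw [mem_ball_zero_iff]
  refine lt_of_pow_lt_pow_left₀ 2 hR.le ?_
  rw [EuclideanSpace.norm_sq_eq]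
  simp only [wrap, Fintype.sum_sum_type, Fin.sum_univ_two, Sum.elim_inl, Sum.elim_inr,
    Matrix.cons_val_zero, Matrix.cons_val_one, Real.norm_eq_abs, sq_abs, mul_pow]
  rw [Real.sq_sqrt (by linarith), Real.sq_sqrt (by linarith)]
  have k1 := sin_sq_add_cos_sq (D.t₁ p)
  have k2 := sin_sq_add_cos_sq (D.t₂ p + D.rotate₂ p)
  calc _ = 2 * (D.s₁ p + D.shift₁ p) + 2 * D.s₂ p := by
        linear_combination 2 * (D.s₁ p + D.shift₁ p) * k1 + 2 * D.s₂ p * k2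
    _ < R ^ 2 := by linarith

end WrappingData

/-! ### Injectivity and conclusion. -/

/-- Symplectic polar coordinates determine the action, and the angle up to full turns. -/
lemma polar_injective {s t s' t' : ℝ} (hs : 0 < s) (hs' : 0 < s')
    (hc : √(2 * s) * Real.cos t = √(2 * s') * Real.cos t')
    (hn : √(2 * s) * Real.sin t = √(2 * s') * Real.sin t') :
    s = s' ∧ ∃ k : ℤ, t' = t + k * (2 * Real.pi) := by
  have h1 : s = s' := by
    have e1 := Real.sq_sqrt (show 0 ≤ 2 * s by linarith)
    have e2 := Real.sq_sqrt (show 0 ≤ 2 * s' by linarith)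
    have k1 := Real.sin_sq_add_cos_sq t
    have k2 := Real.sin_sq_add_cos_sq t'
    have : √(2 * s) ^ 2 * (Real.sin t ^ 2 + Real.cos t ^ 2) =
        √(2 * s') ^ 2 * (Real.sin t' ^ 2 + Real.cos t' ^ 2) := by
      linear_combination (√(2 * s) * Real.cos t + √(2 * s') * Real.cos t') * hc +
        (√(2 * s) * Real.sin t + √(2 * s') * Real.sin t') * hn
    rw [k1, k2, e1, e2] at this
    linarith
  subst h1
  have hp : √(2 * s) ≠ 0 := (Real.sqrt_pos.2 (by linarith)).ne'
  refine ⟨rfl, ?_⟩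
  have := Real.Angle.cos_sin_inj (mul_left_cancel₀ hp hc) (mul_left_cancel₀ hp hn)
  obtain ⟨k, hk⟩ := Real.Angle.angle_eq_iff_two_pi_dvd_sub.1 this
  exact ⟨-k, by push_cast; linarith⟩

lemma eq_zero_of_abs_int_mul_lt {a : ℝ} {k : ℤ} (h : |k * a| < a) : k = 0 := by
  have ha : 0 < a := (abs_nonneg _).trans_lt h
  rw [abs_mul, abs_of_pos ha, mul_lt_iff_lt_one_left ha] at h
  exact Int.abs_lt_one_iff.1 (by exact_mod_cast h)

namespace WrappingData

open Real

variable {R T : ℝ} {D : WrappingData R T} {N : ℕ} {p q : R2 1 × R2 (N + 2)}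

/-- The parts of the band on the two sides of the ellipse do not meet after the shear. -/
lemma not_meet (hp : p ∈ D.domain N) (hq : q ∈ D.domain N) (hcp : cos (D.angle p) < 0)
    (hcq : ¬ cos (D.angle q) < 0) (hs₁ : D.s₁ p + D.shift₁ p = D.s₁ q + D.shift₁ q)
    (hs₂ : D.s₂ p = D.s₂ q) {k : ℤ}
    (hk : D.t₂ q + D.rotate₂ q = D.t₂ p + D.rotate₂ p + k * (2 * π)) : False := by
  have hp₁ := s₁_mem hp
  have hq₁ := s₁_mem hq
  simp only [shift₁, hcp, hcq, if_true, if_false] at hs₁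
  -- If `χ'` vanishes, the angles separate the sides: their difference lies strictly between 0 and
  -- `2π`. Otherwise the rotation is uncontrolled, but the intervals of first actions are disjoint.
  by_cases hχ : deriv D.χ (D.s₂ p) = 0
  · simp only [rotate₂, hcp, hcq, if_true, if_false, hχ] at hk
    have hrot := D.rotation (D.s₂ q) _ (t₁_mem hq)
    have hp₂ := abs_lt.1 (abs_t₂_lt hp)
    have hq₂ := abs_lt.1 (abs_t₂_lt hq)
    have h1 : D.t₂ p < 0 := mul_neg_of_pos_of_neg D.κ_pos (mul_neg_of_pos_of_neg (radius_pos hp) hcp)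
    have h2 : 0 ≤ D.t₂ q := mul_nonneg D.κ_pos.le (mul_nonneg (radius_pos hq).le (not_lt.1 hcq))
    have h3 : k = 0 := eq_zero_of_abs_int_mul_lt (a := 2 * π) (abs_lt.2
      ⟨by linarith [pi_pos], by linarith⟩)
    rw [h3] at hk
    push_cast at hk
    linarith
  · rw [hs₂] at hχ
    rw [D.displaced _ hχ] at hs₁
    linarith [hp₁.2, hq₁.1]

lemma wrap_injOn : Set.InjOn (D.wrap (N := N)) (D.domain N) := by
  intro p hp q hq hpq
  have g1 : ∀ i, (D.wrap p).1 i = (D.wrap q).1 i := fun i => by rw [hpq]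
  have g2 : ∀ i, (D.wrap p).2 i = (D.wrap q).2 i := fun i => by rw [hpq]
  obtain ⟨hs₁, k₁, hk₁⟩ := polar_injective (s₁_add_shift₁_pos hp) (s₁_add_shift₁_pos hq)
    (g1 (Sum.inl 0)) (g1 (Sum.inr 0))
  obtain ⟨hs₂, k₂, hk₂⟩ := polar_injective (s₂_mem hp).1 (s₂_mem hq).1
    (g1 (Sum.inl 1)) (g1 (Sum.inr 1))
  have hx₃ : p.2 (Sum.inl 1) + D.shift₃ p = q.2 (Sum.inl 1) + D.shift₃ q := g2 (Sum.inl 0)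
  have hy₃ : p.2 (Sum.inr 1) = q.2 (Sum.inr 1) := g2 (Sum.inr 0)
  have hxj : ∀ j : Fin N, p.2 (Sum.inl j.succ.succ) = q.2 (Sum.inl j.succ.succ) :=
    fun j => g2 (Sum.inl j.succ)
  have hyj : ∀ j : Fin N, p.2 (Sum.inr j.succ.succ) = q.2 (Sum.inr j.succ.succ) :=
    fun j => g2 (Sum.inr j.succ)
  have htp := t₁_mem hp
  have htq := t₁_mem hq
  have hk₁0 : k₁ = 0 := eq_zero_of_abs_int_mul_lt (a := 2 * π)
    (abs_lt.2 ⟨by linarith [htp.2, htq.1], by linarith [htp.1, htq.2]⟩)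
  have ht₁ : D.t₁ p = D.t₁ q := by rw [hk₁, hk₁0]; simp
  have hside : cos (D.angle p) < 0 ↔ cos (D.angle q) < 0 := by
    constructor
    · intro h
      by_contra h'
      exact not_meet hp hq h h' hs₁ hs₂ hk₂
    · intro h
      by_contra h'
      exact not_meet (k := -k₂) hq hp h h' hs₁.symm hs₂.symm (by push_cast; linarith)
  have hshift₁ : D.shift₁ p = D.shift₁ q := by simp only [shift₁, hside, hs₂]
  have hrot : D.rotate₂ p = D.rotate₂ q := by simp only [rotate₂, hside, hs₂, hy₃, ht₁]
  have hs₁' : D.s₁ p = D.s₁ q := by linarith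
  -- the first factor
  have hx₁ : p.1 (Sum.inl 0) = q.1 (Sum.inl 0) := by
    have h1 := abs_lt_of_sq_lt_sq' (inl_sq_lt hp) D.ρ_pos.le
    have h2 := abs_lt_of_sq_lt_sq' (inl_sq_lt hq) D.ρ_pos.le
    exact (strictMonoOn_sliceArea D.ρ_pos).injOn ⟨h1.1.le, h1.2.le⟩ ⟨h2.1.le, h2.2.le⟩ hs₁'
  have hy₁ : p.1 (Sum.inr 0) = q.1 (Sum.inr 0) := by
    have hpos : √(D.ρ ^ 2 - q.1 (Sum.inl 0) ^ 2) ≠ 0 :=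
      (Real.sqrt_pos.2 (by linarith [inl_sq_lt hq])).ne'
    simp only [t₁, hx₁, add_left_inj] at ht₁
    rw [div_left_inj' hpos] at ht₁
    exact mul_right_cancel₀ pi_ne_zero ht₁
  -- the turns are separated by the third factor
  have hturn : D.A * turnIndex (D.angle p) + p.2 (Sum.inl 1) =
      D.A * turnIndex (D.angle q) + q.2 (Sum.inl 1) := by
    simp only [shift₃, hside, hs₂] at hx₃
    linarith
  have hp₃ := abs_lt.1 (abs_snd_lt hp (Sum.inl 1))
  have hq₃ := abs_lt.1 (abs_snd_lt hq (Sum.inl 1))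
  have hA := D.two_mul_lt_A
  have hind : turnIndex (D.angle p) - turnIndex (D.angle q) = 0 :=
    eq_zero_of_abs_int_mul_lt (a := D.A) (by
      push_cast
      rw [abs_lt]
      constructor <;> linarith)
  have hind' : turnIndex (D.angle p) = turnIndex (D.angle q) := by linarith
  have hx₃' : p.2 (Sum.inl 1) = q.2 (Sum.inl 1) := by
    rw [hind'] at hturn; linarith
  -- the second factor
  have hp₂ := abs_lt.1 (abs_t₂_lt hp)
  have hq₂ := abs_lt.1 (abs_t₂_lt hq)
  -- Used only to extract `2κm < 2π`.
  have hroom := D.rotation 0 π ⟨pi_pos, by linarith [pi_pos]⟩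
  have hk₂0 : k₂ = 0 := eq_zero_of_abs_int_mul_lt (a := 2 * π)
    (abs_lt.2 ⟨by linarith, by linarith⟩)
  have ht₂ : D.t₂ p = D.t₂ q := by
    rw [hk₂0] at hk₂; push_cast at hk₂; linarith
  have hcos := mul_left_cancel₀ D.κ_pos.ne' ht₂
  have hsin := add_left_cancel hs₂
  have hrad : ∀ p : R2 1 × R2 (N + 2), D.ellipseRadius p =
      √(2 * ((D.q₀ + 2 * p.2 (Sum.inr 0) / (D.Λ * D.κ)) / 2)) := fun p => by
    rw [mul_div_cancel₀ _ two_ne_zero]; rfl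
  rw [hrad p, hrad q] at hcos hsin
  obtain ⟨hr, k, hk⟩ := polar_injective (half_pos (radicand_pos hp)) (half_pos (radicand_pos hq))
    hcos hsin
  -- The point of the ellipse gives the angle modulo `2π`; the equal turn indices remove the
  -- ambiguity.
  have hk0 : k = 0 := by
    have := turnIndex_add_int_mul (D.angle p) k
    rw [← hk] at this
    omega
  have hx₂ : p.2 (Sum.inl 0) = q.2 (Sum.inl 0) := by
    rw [hk0] at hk
    refine mul_left_cancel₀ D.Λ_pos.ne' ?_
    change D.angle p = D.angle q
    simpa using hk.symm
  have hy₂ : p.2 (Sum.inr 0) = q.2 (Sum.inr 0) := by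
    have hΛκ := mul_pos D.Λ_pos D.κ_pos
    have h2 := add_left_cancel ((div_left_inj' two_ne_zero).1 hr)
    rw [div_left_inj' hΛκ.ne'] at h2
    linarith
  refine Prod.ext ?_ ?_
  · ext i
    rcases i with i | i <;> fin_cases i
    exacts [hx₁, hy₁]
  · ext i
    rcases i with i | i <;> refine Fin.cases ?_ (fun i => Fin.cases ?_ (fun i => ?_) i) i
    exacts [hx₂, hx₃', hxj i, hy₂, hy₃, hyj i]

end WrappingData

theorem mainTheorem3 (n : ℕ) (hn : 3 ≤ n) (R : ℝ) (hR : √3 < R) (S : ℝ) (hS : 0 < S) :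
    SymplecticallyEmbeds
      (Metric.closedBall (0 : R2 1) 1 ×ˢ Metric.closedBall (0 : R2 (n - 1)) S)
      (Metric.ball (0 : R2 2) R ×ˢ (Set.univ : Set (R2 (n - 2)))) := by
  obtain ⟨N, rfl⟩ := Nat.exists_eq_add_of_le' hn
  -- Any radius above `S` would do: the closed ball has to lie inside the open domain.
  obtain ⟨D⟩ := exists_wrappingData hR (show 0 < S + 1 by linarith)
  have hR0 : 0 < R := (Real.sqrt_nonneg 3).trans_lt hR
  have hsub : Metric.closedBall (0 : R2 1) 1 ×ˢ Metric.closedBall (0 : R2 (N + 2)) S ⊆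
      D.domain N :=
    Set.prod_mono (Metric.closedBall_subset_ball D.one_lt_ρ)
      (Metric.closedBall_subset_ball (by linarith))
  exact ⟨D.domain N, D.wrap, hsub,
    .of_injOn (by omega) (Metric.isOpen_ball.prod Metric.isOpen_ball)
      (fun p hp => WrappingData.contDiffAt_wrap hp) (fun p hp => WrappingData.wrap_pullback hp)
      WrappingData.wrap_injOn,
    fun p hp => ⟨WrappingData.wrap_mem_ball hR0 (hsub hp), Set.mem_univ _⟩⟩
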